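/- Let $\mathcal H$ be a separable complex Hilbert space. A state on $\mathcal H\otimes\mathcal H$ is a positive trace class operator $\rho$ with $\mathrm{tr}\,\rho=1$; it is symmetric if it is invariant under the permutation of the two factors. For operators on $\mathcal H\otimes\mathcal H\otimes\mathcal H$ let $\mathrm{tr}^{(k)}$ denote the partial trace over the $k$-th factor. A density source-operator of the state $\rho$ is a positive trace class operator $R$ on $\mathcal H\otimes\mathcal H\otimes\mathcal H$ such that either $\mathrm{tr}^{(2)}[R]=\mathrm{tr}^{(3)}[R]=\rho$ (then it is denoted $R_{\blacktriangleright}$) or $\mathrm{tr}^{(1)}[R]=\mathrm{tr}^{(2)}[R]=\rho$ (then it is denoted $R_{\blacktriangleleft}$). A state that has a density source-operator of one of these two types is called a DSO state. Below, an observable is a bounded self-adjoint operator on $\mathcal H$ of operator norm at most $1$. Fix one of the two signs. (i) If $\rho$ is a symmetric DSO state on $\mathcal H\otimes\mathcal H$ and $W_2$ is an observable with $\mathrm{tr}[\rho(W_2\otimes W_2)]=\pm1$, then $\rho$ has a density source-operator $R_{\blacktriangleright}$ such that, for every observable $\widetilde W_2$, $$\mathrm{tr}[\sigma_{R_{\blacktriangleright}}(W_2\otimes\widetilde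 W_2)]=\pm\,\mathrm{tr}[\rho(W_2\otimes\widetilde W_2)],\qquad \sigma_{R_{\blacktriangleright}}=\mathrm{tr}^{(1)}[R_{\blacktriangleright}],$$ with the same sign. (ii) The converse fails, for either sign and even for observables with $W_2^2=I$: if $\dim\mathcal H\ge 2$, there are a symmetric DSO state $\rho$ on $\mathcal H\otimes\mathcal H$ and an observable $W_2$ with $W_2^2=I$ such that, for some density source-operator $R_{\blacktriangleright}$ of $\rho$, the displayed condition holds for every observable $\widetilde W_2$, but $\mathrm{tr}[\rho(W_2\otimes W_2)]\notin\{1,-1\}$. -/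

import Mathlib

open scoped TensorProduct InnerProductSpace

noncomputable section

namespace BellDSO

/-! ### Tensor products of Hilbert spaces -/

/-- The Hilbert space tensor product: the completion of the algebraic tensor product for the
inner product with `⟪a ⊗ b, c ⊗ d⟫ = ⟪a, c⟫ * ⟪b, d⟫`. -/
abbrev HTensor (E F : Type*) [NormedAddCommGroup E] [InnerProductSpace ℂ E]
    [NormedAddCommGroup F] [InnerProductSpace ℂ F] : Type _ :=
  UniformSpace.Completion (E ⊗[ℂ] F)

section Tensor

variable {E F G E' F' : Type*}
  [NormedAddCommGroup E] [InnerProductSpace ℂ E]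
  [NormedAddCommGroup F] [InnerProductSpace ℂ F]
  [NormedAddCommGroup G] [InnerProductSpace ℂ G]
  [NormedAddCommGroup E'] [InnerProductSpace ℂ E']
  [NormedAddCommGroup F'] [InnerProductSpace ℂ F']

/-- The elementary tensor `a ⊗ b`. -/
def tmul (a : E) (b : F) : HTensor E F := ((a ⊗ₜ[ℂ] b : E ⊗[ℂ] F) : HTensor E F)

/-- The bounded operator `A ⊗ B`. -/
def opTensor (A : E →L[ℂ] E') (B : F →L[ℂ] F') : HTensor E F →L[ℂ] HTensor E' F' :=
  (TensorProduct.mapL A B).completion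

/-- The permutation operator `a ⊗ b ↦ b ⊗ a`. -/
def swap (E F : Type*) [NormedAddCommGroup E] [InnerProductSpace ℂ E]
    [NormedAddCommGroup F] [InnerProductSpace ℂ F] : HTensor E F →L[ℂ] HTensor F E :=
  ((TensorProduct.commIsometry ℂ E F).toContinuousLinearEquiv :
    E ⊗[ℂ] F →L[ℂ] F ⊗[ℂ] E).completion

/-- `x ↦ e ⊗ x`. -/
def tmulLeft (e : E) : F →L[ℂ] HTensor E F :=
  UniformSpace.Completion.toComplL ∘L TensorProduct.mkL ℂ E F e

/-- `x ↦ x ⊗ e`. -/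
def tmulRight (e : F) : E →L[ℂ] HTensor E F :=
  UniformSpace.Completion.toComplL ∘L (TensorProduct.mkL ℂ E F).flip e

/-- `a ⊗ c ↦ a ⊗ e ⊗ c`. -/
def insertSecond (e : F) : HTensor E G →L[ℂ] HTensor E (HTensor F G) :=
  opTensor (ContinuousLinearMap.id ℂ E) (tmulLeft e)

/-- `a ⊗ b ↦ a ⊗ b ⊗ e`. -/
def insertThird (e : G) : HTensor E F →L[ℂ] HTensor E (HTensor F G) :=
  opTensor (ContinuousLinearMap.id ℂ E) (tmulRight e)

lemma opTensor_tmul (A : E →L[ℂ] E') (B : F →L[ℂ] F') (a : E) (b : F) :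
    opTensor A B (tmul a b) = tmul (A a) (B b) := by
  simp [opTensor, tmul]

lemma swap_tmul (a : E) (b : F) : swap E F (tmul a b) = tmul b a := by
  simp [swap, tmul]

lemma tmulLeft_apply (e : E) (x : F) : tmulLeft e x = tmul e x := rfl

lemma tmulRight_apply (e : F) (x : E) : tmulRight e x = tmul x e := rfl

lemma insertSecond_tmul (e : F) (a : E) (c : G) :
    insertSecond e (tmul a c) = tmul a (tmul e c) := by
  simp [insertSecond, opTensor_tmul, tmulLeft_apply]

lemma insertThird_tmul (e : G) (a : E) (b : F) :
    insertThird e (tmul a b) = tmul a (tmul b e) := by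
  simp [insertThird, opTensor_tmul, tmulRight_apply]

end Tensor

/-! ### Trace, trace class operators, partial traces -/

section Trace

variable {E F G : Type*}
  [NormedAddCommGroup E] [InnerProductSpace ℂ E] [CompleteSpace E]
  [NormedAddCommGroup F] [InnerProductSpace ℂ F] [CompleteSpace F]
  [NormedAddCommGroup G] [InnerProductSpace ℂ G] [CompleteSpace G]

/-- The index set of a fixed orthonormal (Hilbert) basis of `E`. -/
def basisIndex (E : Type*) [NormedAddCommGroup E] [InnerProductSpace ℂ E] [CompleteSpace E] :
    Set E :=
  (exists_hilbertBasis ℂ E).choose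

/-- A fixed orthonormal (Hilbert) basis of `E`. -/
def stdBasis (E : Type*) [NormedAddCommGroup E] [InnerProductSpace ℂ E] [CompleteSpace E] :
    HilbertBasis (basisIndex E) ℂ E :=
  (exists_hilbertBasis ℂ E).choose_spec.choose

/-- The trace `∑ₙ ⟪eₙ, T eₙ⟫` (meaningful for trace class `T`, where it does not depend on the
orthonormal basis). -/
def trace (T : E →L[ℂ] E) : ℂ := ∑' i, ⟪stdBasis E i, T (stdBasis E i)⟫_ℂ

/-- `T` is trace class: `tr |T| < ∞`, where `|T| = √(T† T)`. -/
def IsTraceClass (T : E →L[ℂ] E) : Prop :=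
  Summable fun i => ⟪stdBasis E i, CFC.abs T (stdBasis E i)⟫_ℂ

/-- A (normal) state: a positive trace class operator of trace one. -/
structure IsDensityOperator (ρ : E →L[ℂ] E) : Prop where
  isPositive : ρ.IsPositive
  isTraceClass : IsTraceClass ρ
  trace_eq_one : trace ρ = 1

/-- Partial trace over the first factor, `∑ₙ Jₙ† T Jₙ` with `Jₙ x = eₙ ⊗ x`. For trace class `T`
the series converges in operator norm; the same holds for the two partial traces below. -/
def ptraceFirst (T : HTensor E F →L[ℂ] HTensor E F) : F →L[ℂ] F :=
  ∑' i, (ContinuousLinearMap.adjoint (tmulLeft (F := F) (stdBasis E i))) ∘L T ∘L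
    tmulLeft (stdBasis E i)

/-- Partial trace over the second of three factors. -/
def ptraceSecond (T : HTensor E (HTensor F G) →L[ℂ] HTensor E (HTensor F G)) :
    HTensor E G →L[ℂ] HTensor E G :=
  ∑' i, (ContinuousLinearMap.adjoint (insertSecond (E := E) (G := G) (stdBasis F i))) ∘L T ∘L
    insertSecond (stdBasis F i)

/-- Partial trace over the third of three factors. -/
def ptraceThird (T : HTensor E (HTensor F G) →L[ℂ] HTensor E (HTensor F G)) :
    HTensor E F →L[ℂ] HTensor E F :=
  ∑' i, (ContinuousLinearMap.adjoint (insertThird (E := E) (F := F) (stdBasis G i))) ∘L T ∘L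
    insertThird (stdBasis G i)

/-! ### Source-operators and DSO states -/

/-- `T` on `E ⊗ E ⊗ F` is a source-operator for `ρ` on `E ⊗ F`. -/
structure IsSourceOperator112 (ρ : HTensor E F →L[ℂ] HTensor E F)
    (T : HTensor E (HTensor E F) →L[ℂ] HTensor E (HTensor E F)) : Prop where
  isSelfAdjoint : IsSelfAdjoint T
  isTraceClass : IsTraceClass T
  ptraceFirst_eq : ptraceFirst T = ρ
  ptraceSecond_eq : ptraceSecond T = ρ

/-- `T` on `E ⊗ F ⊗ F` is a source-operator for `ρ` on `E ⊗ F`. -/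
structure IsSourceOperator122 (ρ : HTensor E F →L[ℂ] HTensor E F)
    (T : HTensor E (HTensor F F) →L[ℂ] HTensor E (HTensor F F)) : Prop where
  isSelfAdjoint : IsSelfAdjoint T
  isTraceClass : IsTraceClass T
  ptraceSecond_eq : ptraceSecond T = ρ
  ptraceThird_eq : ptraceThird T = ρ

/-- Density source-operator on `E ⊗ E ⊗ F`: a positive source-operator. -/
def IsDSO112 (ρ : HTensor E F →L[ℂ] HTensor E F)
    (R : HTensor E (HTensor E F) →L[ℂ] HTensor E (HTensor E F)) : Prop :=
  IsSourceOperator112 ρ R ∧ R.IsPositive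

/-- Density source-operator on `E ⊗ F ⊗ F`: a positive source-operator. -/
def IsDSO122 (ρ : HTensor E F →L[ℂ] HTensor E F)
    (R : HTensor E (HTensor F F) →L[ℂ] HTensor E (HTensor F F)) : Prop :=
  IsSourceOperator122 ρ R ∧ R.IsPositive

/-- A DSO state: a state that has a density source-operator (of one of the two types). -/
def IsDSOState (ρ : HTensor E F →L[ℂ] HTensor E F) : Prop :=
  IsDensityOperator ρ ∧ ((∃ R, IsDSO112 ρ R) ∨ ∃ R, IsDSO122 ρ R)

/-- `ρ` on `E ⊗ E` is symmetric: invariant under the permutation of the two factors. -/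
def IsSymmetricState (ρ : HTensor E E →L[ℂ] HTensor E E) : Prop :=
  swap E E ∘L ρ ∘L swap E E = ρ

/-- A bounded quantum observable with operator norm at most one. -/
def IsUnitObservable (W : E →L[ℂ] E) : Prop := IsSelfAdjoint W ∧ ‖W‖ ≤ 1

/-- The product average `tr[ρ (A ⊗ B)]`. -/
def prodAverage (ρ : HTensor E F →L[ℂ] HTensor E F) (A : E →L[ℂ] E) (B : F →L[ℂ] F) : ℂ :=
  trace (ρ ∘L opTensor A B)

/-- The sufficient condition `tr[σ_R (W ⊗ W')] = s tr[ρ (W ⊗ W')]`, `σ_R = tr⁽¹⁾[R]`, with sign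
`s`, for a state `ρ` on `E ⊗ E`, an operator `R` on `E ⊗ E ⊗ E` and observables `W`, `W'`. -/
def SufficientCondition (s : ℝ) (ρ : HTensor E E →L[ℂ] HTensor E E)
    (R : HTensor E (HTensor E E) →L[ℂ] HTensor E (HTensor E E)) (W W' : E →L[ℂ] E) : Prop :=
  prodAverage (ptraceFirst R) W W' = s * prodAverage ρ W W'

end Trace

end BellDSO

end

open scoped TensorProduct InnerProductSpace

noncomputable section

namespace BellDSO

/-! ### Operators on the completed tensor product -/

section TensorLemmas

variable {E F G E' F' E'' F'' : Type*}
  [NormedAddCommGroup E] [InnerProductSpace ℂ E]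
  [NormedAddCommGroup F] [InnerProductSpace ℂ F]
  [NormedAddCommGroup G] [InnerProductSpace ℂ G]
  [NormedAddCommGroup E'] [InnerProductSpace ℂ E']
  [NormedAddCommGroup F'] [InnerProductSpace ℂ F']
  [NormedAddCommGroup E''] [InnerProductSpace ℂ E'']
  [NormedAddCommGroup F''] [InnerProductSpace ℂ F'']

/-! For (i), conjugation by the reversal `a ⊗ b ⊗ c ↦ c ⊗ b ⊗ a` turns a source-operator of type
`112` of a symmetric state into one of type `122` (`IsSymmetricState.exists_isDSO122`), so let `R`
have type `122`. Write `R = ∑ |vₙ⟩⟨vₙ|`. Tracing out the third factor gives `tr[R (W ⊗ W ⊗ 1)] = s`,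
and `s² = 1`, `‖W‖ ≤ 1` yield `∑ ‖(1 ⊗ W ⊗ 1) vₙ - s (W ⊗ 1 ⊗ 1) vₙ‖² ≤ 2 - 2 s² = 0`. Hence on
every `vₙ` the observable `W` moves from the second factor to the first at the cost of the sign `s`,
which turns `tr[R (1 ⊗ W ⊗ W')]` into `s tr[R (W ⊗ 1 ⊗ W')] = s tr[ρ (W ⊗ W')]`. The carriers are
`IsEnsemble.apply_eq_of_prodAverage_eq` and, for reading partial traces as sums over `vₙ`,
`IsEnsemble.trace_slicedTrace_comp`.

For (ii), classical correlations suffice: take three unbiased bits with pair correlations `1/3`,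
`1/3`, `s/3`, encode them in two orthonormal vectors, and let `W` read off the bit. The condition
holds, while the average of `W ⊗ W` is `1/3`. -/

lemma inner_tmul (a c : E) (b d : F) :
    ⟪tmul a b, tmul c d⟫_ℂ = ⟪a, c⟫_ℂ * ⟪b, d⟫_ℂ := by
  simp [tmul]

lemma hTensor_ext {T T' : HTensor E F →L[ℂ] G} (h : ∀ a b, T (tmul a b) = T' (tmul a b)) :
    T = T' := by
  refine ContinuousLinearMap.ext fun x => ?_
  induction x using UniformSpace.Completion.induction_on with
  | hp => exact isClosed_eq T.continuous T'.continuous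
  | ih x =>
    induction x using TensorProduct.induction_on with
    | zero => rw [UniformSpace.Completion.coe_zero, map_zero, map_zero]
    | tmul a b => exact h a b
    | add x y hx hy => rw [UniformSpace.Completion.coe_add, map_add, map_add, hx, hy]

lemma hTensor_ext_inner {x y : HTensor E F}
    (h : ∀ a b, ⟪tmul a b, x⟫_ℂ = ⟪tmul a b, y⟫_ℂ) : x = y := by
  have : innerSL ℂ x = innerSL ℂ y := hTensor_ext fun a b => by
    simpa using congrArg (starRingEnd ℂ) (h a b)
  exact (innerSL_inj).1 this

lemma opTensor_comp (A : E' →L[ℂ] E'') (B : F' →L[ℂ] F'') (A' : E →L[ℂ] E') (B' : F →L[ℂ] F') :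
    opTensor A B ∘L opTensor A' B' = opTensor (A ∘L A') (B ∘L B') :=
  hTensor_ext fun a b => by simp [opTensor_tmul]

lemma opTensor_id :
    opTensor (ContinuousLinearMap.id ℂ E) (ContinuousLinearMap.id ℂ F) =
      ContinuousLinearMap.id ℂ (HTensor E F) :=
  hTensor_ext fun a b => by simp [opTensor_tmul]

lemma opTensor_zero_right (A : E →L[ℂ] E') :
    opTensor A (0 : F →L[ℂ] F') = 0 :=
  hTensor_ext fun a b => by
    rw [opTensor_tmul]
    simp [tmul]

lemma norm_opTensor_le (A : E →L[ℂ] E') (B : F →L[ℂ] F') : ‖opTensor A B‖ ≤ ‖A‖ * ‖B‖ := by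
  refine ContinuousLinearMap.opNorm_le_bound _ (by positivity) fun x => ?_
  induction x using UniformSpace.Completion.induction_on with
  | hp => exact isClosed_le (by fun_prop) (by fun_prop)
  | ih x =>
    simp only [opTensor, ContinuousLinearMap.completion_apply_coe,
      UniformSpace.Completion.norm_coe]
    exact (ContinuousLinearMap.le_opNorm _ _).trans
      (mul_le_mul_of_nonneg_right (TensorProduct.norm_mapL_le A B) (norm_nonneg _))

lemma adjoint_opTensor [CompleteSpace E] [CompleteSpace F] [CompleteSpace E'] [CompleteSpace F']
    (A : E →L[ℂ] E') (B : F →L[ℂ] F') :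
    ContinuousLinearMap.adjoint (opTensor A B) =
      opTensor (ContinuousLinearMap.adjoint A) (ContinuousLinearMap.adjoint B) :=
  hTensor_ext fun a b => hTensor_ext_inner fun c d => by
    rw [ContinuousLinearMap.adjoint_inner_right, opTensor_tmul, opTensor_tmul, inner_tmul,
      inner_tmul, ContinuousLinearMap.adjoint_inner_right, ContinuousLinearMap.adjoint_inner_right]

lemma adjoint_swap [CompleteSpace E] [CompleteSpace F] :
    ContinuousLinearMap.adjoint (swap E F) = swap F E :=
  hTensor_ext fun a b => hTensor_ext_inner fun c d => by
    rw [ContinuousLinearMap.adjoint_inner_right, swap_tmul, swap_tmul, inner_tmul, inner_tmul,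
      mul_comm]

lemma adjoint_tmulLeft_tmul [CompleteSpace F] (e : E) (a : E) (b : F) :
    ContinuousLinearMap.adjoint (tmulLeft (F := F) e) (tmul a b) = ⟪e, a⟫_ℂ • b :=
  ext_inner_left ℂ fun v => by
    rw [ContinuousLinearMap.adjoint_inner_right, tmulLeft_apply, inner_tmul, inner_smul_right]

lemma adjoint_tmulRight_tmul [CompleteSpace E] (e : F) (a : E) (b : F) :
    ContinuousLinearMap.adjoint (tmulRight (E := E) e) (tmul a b) = ⟪e, b⟫_ℂ • a :=
  ext_inner_left ℂ fun v => by
    rw [ContinuousLinearMap.adjoint_inner_right, tmulRight_apply, inner_tmul, inner_smul_right,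
      mul_comm]

end TensorLemmas

/-! ### Partial traces as sums over orthogonal slices -/

section Slicing

open ContinuousLinearMap

lemma hilbertBasis_hom_ext {ι E G : Type*} [NormedAddCommGroup E] [InnerProductSpace ℂ E]
    [NormedAddCommGroup G] [InnerProductSpace ℂ G] (b : HilbertBasis ι ℂ E) {T T' : E →L[ℂ] G}
    (h : ∀ i, T (b i) = T' (b i)) : T = T' := by
  ext x
  refine ((b.hasSum_repr x).mapL T).unique ?_
  convert! (b.hasSum_repr x).mapL T' using 2
  simp [h]

lemma hilbertBasis_hasSum_norm_sq {ι E : Type*} [NormedAddCommGroup E] [InnerProductSpace ℂ E]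
    (b : HilbertBasis ι ℂ E) (x : E) : HasSum (fun i => ‖⟪b i, x⟫_ℂ‖ ^ 2) (‖x‖ ^ 2) := by
  have h := b.hasSum_inner_mul_inner x x
  rw [inner_self_eq_norm_sq_to_K] at h
  rw [← Complex.hasSum_ofReal]
  convert! h using 2 with i
  · rw [← inner_conj_symm x (b i)]
    rw [Complex.conj_mul']
    simp
  · simp

variable {ι κ K L E : Type*}
  [NormedAddCommGroup K] [InnerProductSpace ℂ K] [CompleteSpace K]
  [NormedAddCommGroup L] [InnerProductSpace ℂ L] [CompleteSpace L]
  [NormedAddCommGroup E] [InnerProductSpace ℂ E]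

/-- A family of isometries `J i : K → L` with pairwise orthogonal ranges spanning a dense
subspace, such as `x ↦ eᵢ ⊗ x` for an orthonormal basis `e`. -/
structure IsSlicing (J : ι → K →L[ℂ] L) : Prop where
  adjoint_comp_self : ∀ i, adjoint (J i) ∘L J i = ContinuousLinearMap.id ℂ K
  adjoint_comp_of_ne : ∀ i j, i ≠ j → adjoint (J i) ∘L J j = 0
  eq_zero : ∀ z, (∀ i x, ⟪J i x, z⟫_ℂ = 0) → z = 0

lemma isSlicing_tmulLeft (b : HilbertBasis ι ℂ E) :
    IsSlicing fun i => (tmulLeft (b i) : K →L[ℂ] HTensor E K) where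
  adjoint_comp_self i := by
    ext x
    simp [tmulLeft_apply, adjoint_tmulLeft_tmul, b.orthonormal.1 i]
  adjoint_comp_of_ne i j h := by
    ext x
    simp [tmulLeft_apply, adjoint_tmulLeft_tmul, b.orthonormal.2 h]
  eq_zero z hz := hTensor_ext_inner fun a x => by
    have : innerSL ℂ z ∘L tmulRight x = 0 := hilbertBasis_hom_ext b fun i => by
      simpa [tmulLeft_apply, tmulRight_apply] using congrArg (starRingEnd ℂ) (hz i x)
    simpa [tmulRight_apply] using congrArg (starRingEnd ℂ) (congr($this a))

lemma isSlicing_tmulRight (b : HilbertBasis ι ℂ E) :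
    IsSlicing fun i => (tmulRight (b i) : K →L[ℂ] HTensor K E) where
  adjoint_comp_self i := by
    ext x
    simp [tmulRight_apply, adjoint_tmulRight_tmul, b.orthonormal.1 i]
  adjoint_comp_of_ne i j h := by
    ext x
    simp [tmulRight_apply, adjoint_tmulRight_tmul, b.orthonormal.2 h]
  eq_zero z hz := hTensor_ext_inner fun x a => by
    have : innerSL ℂ z ∘L tmulLeft x = 0 := hilbertBasis_hom_ext b fun i => by
      simpa [tmulLeft_apply, tmulRight_apply] using congrArg (starRingEnd ℂ) (hz i x)
    simpa [tmulLeft_apply] using congrArg (starRingEnd ℂ) (congr($this a))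

/-- Density of the ranges is inherited by testing on `a ⊗ J i x` and contracting with `a` first.
This yields the slicings for the second and third factors from those of two-fold products. -/
lemma IsSlicing.opTensor_id [CompleteSpace E] {J : ι → K →L[ℂ] L} (hJ : IsSlicing J) :
    IsSlicing fun i => opTensor (ContinuousLinearMap.id ℂ E) (J i) where
  adjoint_comp_self i := by
    rw [adjoint_opTensor, opTensor_comp, hJ.adjoint_comp_self, adjoint_id, comp_id,
      BellDSO.opTensor_id]
  adjoint_comp_of_ne i j h := by
    rw [adjoint_opTensor, opTensor_comp, hJ.adjoint_comp_of_ne i j h, opTensor_zero_right]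
  eq_zero z hz := hTensor_ext_inner fun a y => by
    have : adjoint (tmulLeft a) z = 0 := hJ.eq_zero _ fun i x => by
      rw [adjoint_inner_right, tmulLeft_apply]
      simpa [opTensor_tmul] using hz i (tmul a x)
    rw [← tmulLeft_apply, ← adjoint_inner_right, this, inner_zero_right, inner_zero_right]

variable {J : ι → K →L[ℂ] L}

lemma IsSlicing.inner_same (hJ : IsSlicing J) (i : ι) (x y : K) :
    ⟪J i x, J i y⟫_ℂ = ⟪x, y⟫_ℂ := by
  rw [← adjoint_inner_right, ← comp_apply, hJ.adjoint_comp_self, id_apply]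

lemma IsSlicing.inner_ne (hJ : IsSlicing J) {i j : ι} (h : i ≠ j) (x y : K) :
    ⟪J i x, J j y⟫_ℂ = 0 := by
  rw [← adjoint_inner_right, ← comp_apply, hJ.adjoint_comp_of_ne i j h, zero_apply,
    inner_zero_right]

lemma IsSlicing.orthonormal (hJ : IsSlicing J) (b : HilbertBasis κ ℂ K) :
    Orthonormal ℂ fun p : ι × κ => J p.1 (b p.2) := by
  refine ⟨fun p => ?_, fun p q h => ?_⟩
  · rw [@norm_eq_sqrt_re_inner ℂ, hJ.inner_same, ← @norm_eq_sqrt_re_inner ℂ, b.orthonormal.1]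
  · by_cases h1 : p.1 = q.1
    · have h2 : p.2 ≠ q.2 := fun h2 => h (Prod.ext h1 h2)
      simp only [h1, hJ.inner_same, b.orthonormal.2 h2]
    · exact hJ.inner_ne h1 _ _

lemma IsSlicing.span_orthogonal (hJ : IsSlicing J) (b : HilbertBasis κ ℂ K) :
    (Submodule.span ℂ (Set.range fun p : ι × κ => J p.1 (b p.2)))ᗮ = ⊥ := by
  refine (Submodule.eq_bot_iff _).2 fun z hz => hJ.eq_zero z fun i x => ?_
  have : innerSL ℂ z ∘L J i = 0 := hilbertBasis_hom_ext b fun k => by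
    have hmem : J i (b k) ∈ Submodule.span ℂ (Set.range fun p : ι × κ => J p.1 (b p.2)) :=
      Submodule.subset_span ⟨(i, k), rfl⟩
    simpa using Submodule.inner_left_of_mem_orthogonal hmem hz
  simpa using congrArg (starRingEnd ℂ) (congr($this x))

/-- The orthonormal basis `J i (b k)` of `L`. -/
def IsSlicing.basis (hJ : IsSlicing J) (b : HilbertBasis κ ℂ K) : HilbertBasis (ι × κ) ℂ L :=
  HilbertBasis.mkOfOrthogonalEqBot (hJ.orthonormal b) (hJ.span_orthogonal b)

lemma IsSlicing.basis_apply (hJ : IsSlicing J) (b : HilbertBasis κ ℂ K) (p : ι × κ) :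
    hJ.basis b p = J p.1 (b p.2) := by
  rw [IsSlicing.basis, HilbertBasis.coe_mkOfOrthogonalEqBot]

/-- Parseval in the basis `J i (b k)`, grouped by `i`. -/
lemma IsSlicing.hasSum_norm_sq (hJ : IsSlicing J) (x : L) :
    HasSum (fun i => ‖adjoint (J i) x‖ ^ 2) (‖x‖ ^ 2) := by
  refine (hilbertBasis_hasSum_norm_sq (hJ.basis (stdBasis K)) x).prod_fiberwise fun i => ?_
  simpa only [IsSlicing.basis_apply, adjoint_inner_right] using
    hilbertBasis_hasSum_norm_sq (stdBasis K) (adjoint (J i) x)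

end Slicing

/-! ### Ensemble decompositions and trace identities -/

section Ensemble

open ContinuousLinearMap

variable {ι κ K L : Type*}
  [NormedAddCommGroup K] [InnerProductSpace ℂ K] [CompleteSpace K]
  [NormedAddCommGroup L] [InnerProductSpace ℂ L] [CompleteSpace L]

lemma isTraceClass_iff {R : L →L[ℂ] L} (hR : R.IsPositive) :
    IsTraceClass R ↔ Summable fun i => ⟪stdBasis L i, R (stdBasis L i)⟫_ℂ := by
  rw [IsTraceClass, CFC.abs_of_nonneg R ((nonneg_iff_isPositive R).2 hR)]

/-- `R = ∑ₙ |vₙ⟩⟨vₙ|` (weakly) with `∑ₙ ‖vₙ‖² < ∞`. -/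
structure IsEnsemble (v : κ → L) (R : L →L[ℂ] L) : Prop where
  summable : Summable fun n => ‖v n‖ ^ 2
  hasSum_inner : ∀ x y, HasSum (fun n => ⟪x, v n⟫_ℂ * ⟪v n, y⟫_ℂ) ⟪x, R y⟫_ℂ

/-- The vectors `√R eₙ` work: their squared norms sum to the trace, and the weak expansion is
Parseval for `√R x` and `√R y`. No eigenvectors are needed. -/
lemma exists_isEnsemble {R : L →L[ℂ] L} (hR : R.IsPositive) (ht : IsTraceClass R) :
    ∃ v : basisIndex L → L, IsEnsemble v R := by
  have h0 : 0 ≤ R := (nonneg_iff_isPositive R).2 hR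
  have hsa : adjoint (CFC.sqrt R) = CFC.sqrt R :=
    (IsSelfAdjoint.of_nonneg (CFC.sqrt_nonneg R)).adjoint_eq
  have key : ∀ x y, ⟪CFC.sqrt R x, CFC.sqrt R y⟫_ℂ = ⟪x, R y⟫_ℂ := fun x y => by
    conv_rhs => rw [← CFC.sqrt_mul_sqrt_self R h0]
    change _ = ⟪x, CFC.sqrt R (CFC.sqrt R y)⟫_ℂ
    rw [← adjoint_inner_left (CFC.sqrt R) (CFC.sqrt R y), hsa]
  refine ⟨fun n => CFC.sqrt R (stdBasis L n), ?_, fun x y => ?_⟩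
  · rw [isTraceClass_iff hR] at ht
    convert! (Complex.hasSum_re ht.hasSum).summable using 2 with n
    rw [← key, ← inner_self_eq_norm_sq (𝕜 := ℂ)]
    rfl
  · rw [← key]
    convert! (stdBasis L).hasSum_inner_mul_inner (CFC.sqrt R x) (CFC.sqrt R y) using 3 with n
    · rw [← adjoint_inner_left, hsa]
    · rw [← adjoint_inner_right, hsa]

variable {v : κ → L} {R : L →L[ℂ] L}

omit [CompleteSpace L] in
lemma IsEnsemble.summable_norm_sq (hv : IsEnsemble v R) (B : L →L[ℂ] L) :
    Summable fun n => ‖B (v n)‖ ^ 2 := by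
  refine (hv.summable.mul_left (‖B‖ ^ 2)).of_nonneg_of_le (fun n => by positivity) fun n => ?_
  rw [← mul_pow]
  exact pow_le_pow_left₀ (norm_nonneg _) (B.le_opNorm _) 2

omit [CompleteSpace L] in
lemma IsEnsemble.summable_inner (hv : IsEnsemble v R) (B : L →L[ℂ] L) :
    Summable fun n => ⟪v n, B (v n)⟫_ℂ := by
  refine (hv.summable.mul_right ‖B‖).of_norm_bounded fun n => ?_
  calc ‖⟪v n, B (v n)⟫_ℂ‖ ≤ ‖v n‖ * ‖B (v n)‖ := norm_inner_le_norm _ _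
    _ ≤ ‖v n‖ * (‖B‖ * ‖v n‖) := by gcongr; exact B.le_opNorm _
    _ = ‖v n‖ ^ 2 * ‖B‖ := by ring

/-- Absolute convergence that permits exchanging the sums over the ensemble and the basis. Each
product is dominated by a sum of squares, which Parseval controls. -/
lemma IsEnsemble.summable_prod (hv : IsEnsemble v R) (b : HilbertBasis ι ℂ L) (B : L →L[ℂ] L) :
    Summable fun p : κ × ι => ⟪b p.2, v p.1⟫_ℂ * ⟪v p.1, B (b p.2)⟫_ℂ := by
  have key : ∀ C : L →L[ℂ] L, Summable fun p : κ × ι => ‖⟪b p.2, C (v p.1)⟫_ℂ‖ ^ 2 := fun C => by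
    rw [summable_prod_of_nonneg fun p => by positivity]
    refine ⟨fun n => (hilbertBasis_hasSum_norm_sq b (C (v n))).summable, ?_⟩
    simpa only [(hilbertBasis_hasSum_norm_sq b _).tsum_eq] using hv.summable_norm_sq C
  refine ((key (.id ℂ L)).add (key (adjoint B))).of_norm_bounded fun p => ?_
  rw [norm_mul, ← adjoint_inner_left, norm_inner_symm (adjoint B _), id_apply]
  nlinarith [sq_nonneg (‖⟪b p.2, v p.1⟫_ℂ‖ - ‖⟪b p.2, (adjoint B) (v p.1)⟫_ℂ‖),
    sq_nonneg (‖⟪b p.2, v p.1⟫_ℂ‖ + ‖⟪b p.2, (adjoint B) (v p.1)⟫_ℂ‖)]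

/-- The value does not involve `b`, so the trace may be computed in a basis adapted to a slicing. -/
lemma IsEnsemble.hasSum_trace (hv : IsEnsemble v R) (b : HilbertBasis ι ℂ L) (B : L →L[ℂ] L) :
    HasSum (fun i => ⟪b i, R (B (b i))⟫_ℂ) (∑' n, ⟪v n, B (v n)⟫_ℂ) := by
  have hs := hv.summable_prod b B
  have h1 := hs.hasSum.prod_fiberwise (g := fun n => ⟪v n, B (v n)⟫_ℂ) fun n => by
    simpa only [adjoint_inner_left, mul_comm] using
      b.hasSum_inner_mul_inner (adjoint B (v n)) (v n)
  rw [h1.tsum_eq]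
  exact ((Equiv.prodComm ι κ).hasSum_iff.2 hs.hasSum).prod_fiberwise fun i =>
    hv.hasSum_inner (b i) (B (b i))

lemma IsEnsemble.trace_comp (hv : IsEnsemble v R) (B : L →L[ℂ] L) :
    trace (R ∘L B) = ∑' n, ⟪v n, B (v n)⟫_ℂ :=
  (hv.hasSum_trace (stdBasis L) B).tsum_eq

lemma IsEnsemble.summable_adjoint (hv : IsEnsemble v R) {J : ι → K →L[ℂ] L} (hJ : IsSlicing J) :
    Summable fun p : ι × κ => ‖adjoint (J p.1) (v p.2)‖ ^ 2 := by
  have : Summable fun p : κ × ι => ‖adjoint (J p.2) (v p.1)‖ ^ 2 := by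
    rw [summable_prod_of_nonneg fun p => by positivity]
    refine ⟨fun n => (hJ.hasSum_norm_sq (v n)).summable, ?_⟩
    simpa only [(hJ.hasSum_norm_sq _).tsum_eq] using hv.summable
  exact this.prod_symm

/-- Cauchy–Schwarz on unit vectors. The bounds are summable over a slicing, so partial traces
converge in operator norm. -/
lemma IsEnsemble.norm_slice_le (hv : IsEnsemble v R) (J : K →L[ℂ] L)
    (hs : Summable fun n => ‖adjoint J (v n)‖ ^ 2) :
    ‖adjoint J ∘L R ∘L J‖ ≤ ∑' n, ‖adjoint J (v n)‖ ^ 2 := by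
  refine opNorm_le_of_re_inner_le (tsum_nonneg fun n => by positivity) fun x y hx hy => ?_
  refine (Complex.re_le_norm _).trans ?_
  rw [norm_inner_symm, comp_apply, comp_apply, adjoint_inner_right]
  refine (hv.hasSum_inner (J y) (J x)).norm_le_of_bounded hs.hasSum fun n => ?_
  rw [norm_mul, ← adjoint_inner_right J y (v n), ← adjoint_inner_left J x (v n), sq]
  gcongr
  · exact (norm_inner_le_norm _ _).trans_eq (by rw [hy, one_mul])
  · exact (norm_inner_le_norm _ _).trans_eq (by rw [hx, mul_one])

lemma IsEnsemble.conj (hv : IsEnsemble v R) (J : K →L[ℂ] L) :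
    IsEnsemble (fun n => adjoint J (v n)) (adjoint J ∘L R ∘L J) where
  summable := by
    refine (hv.summable.mul_left (‖adjoint J‖ ^ 2)).of_nonneg_of_le (fun n => by positivity)
      fun n => ?_
    rw [← mul_pow]
    exact pow_le_pow_left₀ (norm_nonneg _) (le_opNorm _ _) 2
  hasSum_inner x y := by
    simpa only [adjoint_inner_right, adjoint_inner_left, comp_apply] using
      hv.hasSum_inner (J x) (J y)

lemma IsEnsemble.isTraceClass (hv : IsEnsemble v R) (hR : R.IsPositive) : IsTraceClass R :=
  (isTraceClass_iff hR).2 (hv.hasSum_trace (stdBasis L) (.id ℂ L)).summable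

/-- The partial trace of `R` along the slices `J i`. -/
def slicedTrace (J : ι → K →L[ℂ] L) (R : L →L[ℂ] L) : K →L[ℂ] K :=
  ∑' i, adjoint (J i) ∘L R ∘L J i

lemma IsEnsemble.summable_slices (hv : IsEnsemble v R) {J : ι → K →L[ℂ] L} (hJ : IsSlicing J) :
    Summable fun i => adjoint (J i) ∘L R ∘L J i := by
  have h := hv.summable_adjoint hJ
  exact h.prod.of_norm_bounded fun i => hv.norm_slice_le (J i) (h.prod_factor i)

/-- The intertwining relation and its adjoint identify the two series term by term; conjugation by
`U` is continuous and passes through the sum. -/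
lemma IsEnsemble.slicedTrace_conj (hv : IsEnsemble v R) {J J' : ι → K →L[ℂ] L}
    (hJ : IsSlicing J) {V : L →L[ℂ] L} {U : K →L[ℂ] K} (h : ∀ i, V ∘L J' i = J i ∘L U) :
    slicedTrace J' (adjoint V ∘L R ∘L V) = adjoint U ∘L slicedTrace J R ∘L U := by
  have h1 := (hv.summable_slices hJ).hasSum.mapL
    ((compL ℂ K K K (adjoint U)) ∘L ((compL ℂ K K K).flip U))
  refine HasSum.tsum_eq (h1.congr_fun fun i => ?_)
  have h2 : adjoint (J' i) ∘L adjoint V = adjoint U ∘L adjoint (J i) := by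
    rw [← adjoint_comp, h, adjoint_comp]
  change (adjoint (J' i) ∘L adjoint V) ∘L R ∘L (V ∘L J' i) = _
  rw [h, h2]
  rfl

/-- Duality of partial trace and ampliation: both sides are `tr[R C]`, computed in the basis `J i (e
k)` by summing over `i` first. -/
lemma IsEnsemble.trace_slicedTrace_comp (hv : IsEnsemble v R) {J : ι → K →L[ℂ] L}
    (hJ : IsSlicing J) {B : K →L[ℂ] K} {C : L →L[ℂ] L} (h : ∀ i, J i ∘L B = C ∘L J i) :
    trace (slicedTrace J R ∘L B) = ∑' n, ⟪v n, C (v n)⟫_ℂ := by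
  have h1 := (Equiv.prodComm _ _).hasSum_iff.2 (hv.hasSum_trace (hJ.basis (stdBasis K)) C)
  refine (h1.prod_fiberwise fun k => ?_).tsum_eq
  have h2 := ((hv.summable_slices hJ).hasSum.mapL
    (ContinuousLinearMap.apply ℂ K (B (stdBasis K k)))).mapL (innerSL ℂ (stdBasis K k))
  convert! h2 using 2 with i
  have h3 : J i (B (stdBasis K k)) = C (J i (stdBasis K k)) := congr($(h i) (stdBasis K k))
  simp [IsSlicing.basis_apply, h3, adjoint_inner_right]

end Ensemble

/-! ### Perfect correlation and source-operators on three factors -/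

section Tripartite

open ContinuousLinearMap

variable {κ E : Type*} [NormedAddCommGroup E] [InnerProductSpace ℂ E] [CompleteSpace E]

lemma isSlicing_insertSecond :
    IsSlicing fun i => (insertSecond (stdBasis E i) : HTensor E E →L[ℂ] HTensor E (HTensor E E)) :=
  (isSlicing_tmulLeft (stdBasis E)).opTensor_id

lemma isSlicing_insertThird :
    IsSlicing fun i => (insertThird (stdBasis E i) : HTensor E E →L[ℂ] HTensor E (HTensor E E)) :=
  (isSlicing_tmulRight (stdBasis E)).opTensor_id

lemma ptraceFirst_eq_slicedTrace (R : HTensor E (HTensor E E) →L[ℂ] HTensor E (HTensor E E)) :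
    ptraceFirst R = slicedTrace (fun i => tmulLeft (stdBasis E i)) R := rfl

lemma ptraceSecond_eq_slicedTrace (R : HTensor E (HTensor E E) →L[ℂ] HTensor E (HTensor E E)) :
    ptraceSecond R = slicedTrace (fun i => insertSecond (stdBasis E i)) R := rfl

lemma ptraceThird_eq_slicedTrace (R : HTensor E (HTensor E E) →L[ℂ] HTensor E (HTensor E E)) :
    ptraceThird R = slicedTrace (fun i => insertThird (stdBasis E i)) R := rfl

variable {v : κ → HTensor E (HTensor E E)}
  {R : HTensor E (HTensor E E) →L[ℂ] HTensor E (HTensor E E)}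

lemma IsEnsemble.prodAverage_ptraceFirst (hv : IsEnsemble v R) (A B : E →L[ℂ] E) :
    prodAverage (ptraceFirst R) A B =
      ∑' n, ⟪v n, opTensor (.id ℂ E) (opTensor A B) (v n)⟫_ℂ :=
  hv.trace_slicedTrace_comp (isSlicing_tmulLeft (stdBasis E)) fun i => hTensor_ext fun a b => by
    simp [tmulLeft_apply, opTensor_tmul]

lemma IsEnsemble.prodAverage_ptraceSecond (hv : IsEnsemble v R) (A B : E →L[ℂ] E) :
    prodAverage (ptraceSecond R) A B =
      ∑' n, ⟪v n, opTensor A (opTensor (.id ℂ E) B) (v n)⟫_ℂ :=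
  hv.trace_slicedTrace_comp isSlicing_insertSecond fun i => hTensor_ext fun a b => by
    simp [insertSecond_tmul, opTensor_tmul]

lemma IsEnsemble.prodAverage_ptraceThird (hv : IsEnsemble v R) (A B : E →L[ℂ] E) :
    prodAverage (ptraceThird R) A B =
      ∑' n, ⟪v n, opTensor A (opTensor B (.id ℂ E)) (v n)⟫_ℂ :=
  hv.trace_slicedTrace_comp isSlicing_insertThird fun i => hTensor_ext fun a b => by
    simp [insertThird_tmul, opTensor_tmul]

lemma IsUnitObservable.norm_opTensor_id_le {F : Type*} [NormedAddCommGroup F]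
    [InnerProductSpace ℂ F] {W : E →L[ℂ] E} (hW : IsUnitObservable W) :
    ‖opTensor W (.id ℂ F)‖ ≤ 1 :=
  (norm_opTensor_le _ _).trans (mul_le_one₀ hW.2 (norm_nonneg _) norm_id_le)

/-- Perfect (anti)correlation of `W` on the first two factors: `1 ⊗ W ⊗ 1` and `±(W ⊗ 1 ⊗ 1)`
agree on every vector of the ensemble. -/
lemma IsEnsemble.apply_eq_of_prodAverage_eq (hv : IsEnsemble v R) {W : E →L[ℂ] E}
    (hW : IsUnitObservable W) {s : ℝ} (hs : s * s = 1) (h1 : trace (ptraceThird R) = 1)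
    (h : prodAverage (ptraceThird R) W W = s) (n : κ) :
    opTensor (.id ℂ E) (opTensor W (.id ℂ E)) (v n) =
      (s : ℂ) • opTensor W (.id ℂ (HTensor E E)) (v n) := by
  have hP : ∀ x : HTensor E (HTensor E E),
      ‖opTensor (.id ℂ E) (opTensor W (.id ℂ E)) x‖ ≤ ‖x‖ := fun x => by
    refine (le_of_opNorm_le _ ((norm_opTensor_le _ _).trans ?_) x).trans_eq (one_mul _)
    exact mul_le_one₀ norm_id_le (norm_nonneg _) hW.norm_opTensor_id_le
  have hQ : ∀ x : HTensor E (HTensor E E), ‖opTensor W (.id ℂ (HTensor E E)) x‖ ≤ ‖x‖ := fun x =>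
    (le_of_opNorm_le _ hW.norm_opTensor_id_le x).trans_eq (one_mul _)
  have hQP : ∀ x : HTensor E (HTensor E E), ⟪opTensor (.id ℂ E) (opTensor W (.id ℂ E)) x,
      opTensor W (.id ℂ (HTensor E E)) x⟫_ℂ = ⟪x, opTensor W (opTensor W (.id ℂ E)) x⟫_ℂ :=
    fun x => by
    rw [← adjoint_inner_right, adjoint_opTensor, adjoint_opTensor, hW.1.adjoint_eq, adjoint_id,
      ← comp_apply, opTensor_comp, id_comp, comp_id]
  have hcorr := (hv.summable_inner (opTensor W (opTensor W (.id ℂ E)))).hasSum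
  rw [← hv.prodAverage_ptraceThird, h] at hcorr
  have hone := (hv.summable_inner (.id ℂ _)).hasSum
  rw [← hv.trace_slicedTrace_comp isSlicing_insertThird (B := .id ℂ _) fun i => rfl, comp_id,
    ← ptraceThird_eq_slicedTrace, h1] at hone
  -- The total is `2 tr ρ - 2 s · s = 0`; its terms dominate the squared distances below, so all of
  -- these vanish.
  have hg := ((Complex.hasSum_re hone).mul_left 2).sub ((Complex.hasSum_re hcorr).mul_left (2 * s))
  have hle : ∀ n, ‖opTensor (.id ℂ E) (opTensor W (.id ℂ E)) (v n) -
      (s : ℂ) • opTensor W (.id ℂ (HTensor E E)) (v n)‖ ^ 2 ≤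
      2 * (⟪v n, v n⟫_ℂ).re - 2 * s * (⟪v n, opTensor W (opTensor W (.id ℂ E)) (v n)⟫_ℂ).re := by
    intro n
    have h2 : (⟪v n, v n⟫_ℂ).re = ‖v n‖ ^ 2 := inner_self_eq_norm_sq (𝕜 := ℂ) (v n)
    have h3 := pow_le_pow_left₀ (norm_nonneg _) (hP (v n)) 2
    have h4 := pow_le_pow_left₀ (norm_nonneg _) (hQ (v n)) 2
    rw [@norm_sub_sq ℂ, inner_smul_right, hQP, norm_smul, mul_pow, Complex.norm_real,
      Real.norm_eq_abs, sq_abs, sq s, hs, h2]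
    simp only [RCLike.re_to_complex, Complex.re_ofReal_mul]
    linarith
  have hzero : 2 * (1 : ℂ).re - 2 * s * (s : ℂ).re = 0 := by
    rw [Complex.one_re, Complex.ofReal_re]
    linarith
  rw [hzero] at hg
  have := (hle n).trans_eq (congrFun
    ((hasSum_zero_iff_of_nonneg fun n => (sq_nonneg _).trans (hle n)).1 hg) n)
  rw [← sub_eq_zero, ← norm_eq_zero]
  exact pow_eq_zero_iff two_ne_zero |>.1 (le_antisymm this (by positivity))

lemma IsDSO122.sufficientCondition {ρ : HTensor E E →L[ℂ] HTensor E E} (hR : IsDSO122 ρ R)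
    (hρ : trace ρ = 1) {W : E →L[ℂ] E} (hW : IsUnitObservable W) {s : ℝ} (hs : s * s = 1)
    (h : prodAverage ρ W W = s) (W' : E →L[ℂ] E) : SufficientCondition s ρ R W W' := by
  obtain ⟨v, hv⟩ := exists_isEnsemble hR.2 hR.1.isTraceClass
  have h3 := hR.1.ptraceThird_eq
  have key := hv.apply_eq_of_prodAverage_eq hW hs (h3 ▸ hρ) (h3 ▸ h)
  rw [SufficientCondition, hv.prodAverage_ptraceFirst, ← hR.1.ptraceSecond_eq,
    hv.prodAverage_ptraceSecond, ← tsum_mul_left]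
  congr 1 with n
  -- Splitting off `W` as an adjoint puts it on the left vector of the inner product, where `key`
  -- applies.
  have e1 : opTensor (.id ℂ E) (opTensor W W') = adjoint (opTensor (.id ℂ E)
      (opTensor W (.id ℂ E))) ∘L opTensor (.id ℂ E) (opTensor (.id ℂ E) W') := by
    simp [adjoint_opTensor, opTensor_comp, hW.1.adjoint_eq, adjoint_id]
  have e2 : opTensor W (opTensor (.id ℂ E) W') = adjoint (opTensor W
      (.id ℂ (HTensor E E))) ∘L opTensor (.id ℂ E) (opTensor (.id ℂ E) W') := by
    simp [adjoint_opTensor, opTensor_comp, hW.1.adjoint_eq, adjoint_id]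
  rw [e1, e2, comp_apply, comp_apply, adjoint_inner_right, adjoint_inner_right, key,
    inner_smul_left, Complex.conj_ofReal]

/-- The operator `a ⊗ b ⊗ c ↦ c ⊗ b ⊗ a`, in terms of slices. -/
lemma exists_reversal (E : Type*) [NormedAddCommGroup E] [InnerProductSpace ℂ E]
    [CompleteSpace E] :
    ∃ V : HTensor E (HTensor E E) →L[ℂ] HTensor E (HTensor E E),
      (∀ i, V ∘L insertSecond (stdBasis E i) = insertSecond (stdBasis E i) ∘L swap E E) ∧
      ∀ i, V ∘L insertThird (stdBasis E i) = tmulLeft (stdBasis E i) ∘L swap E E := by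
  let e := stdBasis E
  let c := (isSlicing_tmulLeft (K := E) e).basis e
  let b := (isSlicing_tmulLeft (K := HTensor E E) e).basis c
  have hc : ∀ p, c p = tmul (e p.1) (e p.2) := IsSlicing.basis_apply _ _
  have hb : ∀ i j k, b (i, j, k) = tmul (e i) (tmul (e j) (e k)) := fun i j k => by
    rw [← hc (j, k)]
    exact IsSlicing.basis_apply _ _ _
  let σ : basisIndex E × basisIndex E × basisIndex E → basisIndex E × basisIndex E × basisIndex E :=
    fun p => (p.2.2, p.2.1, p.1)
  have hσ : Function.Involutive σ := fun p => rfl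
  let b' : HilbertBasis (basisIndex E × basisIndex E × basisIndex E) ℂ _ :=
    HilbertBasis.mk (b.orthonormal.comp σ hσ.injective) (by
      rw [hσ.surjective.range_comp, b.dense_span])
  -- The unitary that carries the product basis to itself with the outer two indices exchanged.
  let V := b.repr.trans b'.repr.symm
  have hV : ∀ p, V (b p) = b (σ p) := fun p => by
    classical
    simp only [V, LinearIsometryEquiv.trans_apply, HilbertBasis.repr_self,
      HilbertBasis.repr_symm_single]
    exact congrFun (HilbertBasis.coe_mk _ _) p
  have hV' : ∀ i j k, V (tmul (e i) (tmul (e j) (e k))) = tmul (e k) (tmul (e j) (e i)) :=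
    fun i j k => by rw [← hb, hV, hb]
  refine ⟨V.toContinuousLinearEquiv, fun i => hilbertBasis_hom_ext c fun p => ?_,
    fun i => hilbertBasis_hom_ext c fun p => ?_⟩
  · rw [hc, comp_apply, comp_apply, insertSecond_tmul, swap_tmul, insertSecond_tmul]
    exact hV' _ _ _
  · rw [hc, comp_apply, comp_apply, insertThird_tmul, swap_tmul, tmulLeft_apply]
    exact hV' _ _ _

/-- Reversal exchanges the traces over the first and third factors and keeps the one over the
second, up to a swap of the remaining factors, which symmetry of `ρ` absorbs. -/
lemma IsSymmetricState.exists_isDSO122 {ρ : HTensor E E →L[ℂ] HTensor E E}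
    (hsymm : IsSymmetricState ρ) (hρ : IsDSOState ρ) : ∃ R, IsDSO122 ρ R := by
  rcases hρ.2 with ⟨T, hT⟩ | h
  swap
  · exact h
  obtain ⟨v, hv⟩ := exists_isEnsemble hT.2 hT.1.isTraceClass
  obtain ⟨V, hV2, hV3⟩ := exists_reversal E
  have hpos : (adjoint V ∘L T ∘L V).IsPositive := hT.2.adjoint_conj V
  refine ⟨adjoint V ∘L T ∘L V, ⟨hpos.isSelfAdjoint, (hv.conj V).isTraceClass hpos, ?_, ?_⟩, hpos⟩
  · rw [ptraceSecond_eq_slicedTrace, hv.slicedTrace_conj isSlicing_insertSecond hV2,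
      ← ptraceSecond_eq_slicedTrace, hT.1.ptraceSecond_eq, adjoint_swap]
    exact hsymm
  · rw [ptraceThird_eq_slicedTrace, hv.slicedTrace_conj (isSlicing_tmulLeft (stdBasis E)) hV3,
      ← ptraceFirst_eq_slicedTrace, hT.1.ptraceFirst_eq, adjoint_swap]
    exact hsymm

end Tripartite

/-! ### Finite mixtures of pure states -/

section Mixture

open ContinuousLinearMap InnerProductSpace

variable {ι κ K L : Type*} [Fintype κ]
  [NormedAddCommGroup K] [InnerProductSpace ℂ K] [CompleteSpace K]
  [NormedAddCommGroup L] [InnerProductSpace ℂ L]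

/-- The finite mixture `∑ₙ pₙ |vₙ⟩⟨vₙ|`. -/
def mixture (p : κ → ℝ) (v : κ → L) : L →L[ℂ] L :=
  ∑ n, (p n : ℂ) • rankOne ℂ (v n) (v n)

variable {p : κ → ℝ} (v : κ → L)

lemma mixture_isPositive (hp : ∀ n, 0 ≤ p n) : (mixture p v).IsPositive :=
  isPositive_sum _ fun n _ =>
    (isPositive_rankOne_self (v n)).smul_of_nonneg (Complex.zero_le_real.2 (hp n))

lemma mixture_isEnsemble (hp : ∀ n, 0 ≤ p n) :
    IsEnsemble (fun n => (√(p n) : ℂ) • v n) (mixture p v) where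
  summable := (hasSum_fintype _).summable
  hasSum_inner x y := by
    convert! hasSum_fintype _ using 1
    rw [mixture, sum_apply, inner_sum]
    refine Finset.sum_congr rfl fun n _ => ?_
    have h : (p n : ℂ) = √(p n) * √(p n) := by
      rw [← Complex.ofReal_mul, Real.mul_self_sqrt (hp n)]
    simp only [smul_apply, rankOne_apply, inner_smul_left, inner_smul_right, Complex.conj_ofReal, h]
    ring

variable [CompleteSpace L]

lemma mixture_isTraceClass (hp : ∀ n, 0 ≤ p n) : IsTraceClass (mixture p v) :=
  (mixture_isEnsemble v hp).isTraceClass (mixture_isPositive v hp)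

lemma trace_mixture_comp (hp : ∀ n, 0 ≤ p n) (B : L →L[ℂ] L) :
    trace (mixture p v ∘L B) = ∑ n, (p n : ℂ) * ⟪v n, B (v n)⟫_ℂ := by
  rw [(mixture_isEnsemble v hp).trace_comp, tsum_fintype]
  refine Finset.sum_congr rfl fun n _ => ?_
  have h : (p n : ℂ) = √(p n) * √(p n) := by
    rw [← Complex.ofReal_mul, Real.mul_self_sqrt (hp n)]
  simp only [map_smul, inner_smul_left, inner_smul_right, Complex.conj_ofReal, h]
  ring

/-- Tracing out a unit factor of a product vector just deletes it: `c n i` is the `i`-th coordinate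
of the deleted factor. -/
lemma slicedTrace_mixture {J : ι → K →L[ℂ] L} {v : κ → L} {w : κ → K} {c : κ → ι → ℂ}
    (h : ∀ n i, adjoint (J i) (v n) = c n i • w n) (hc : ∀ n, HasSum (fun i => ‖c n i‖ ^ 2) 1) :
    slicedTrace J (mixture p v) = mixture p w := by
  have h1 : ∀ n, HasSum (fun i => (p n : ℂ) • (adjoint (J i) ∘L rankOne ℂ (v n) (v n) ∘L J i))
      ((p n : ℂ) • rankOne ℂ (w n) (w n)) := fun n => by
    convert! ((Complex.hasSum_ofReal.2 (hc n)).smul_const (rankOne ℂ (w n) (w n))).const_smul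
      (p n : ℂ) using 1
    · ext1 i
      rw [rankOne_comp, comp_rankOne, h]
      simp [smul_smul, Complex.mul_conj']
    · simp
  refine HasSum.tsum_eq ((hasSum_sum fun n _ => h1 n).congr_fun fun i => ?_)
  rw [mixture, finsetSum_comp, comp_finsetSum]
  simp only [smul_comp, comp_smul]

end Mixture

/-! ### The classically correlated counterexample -/

section Counterexample

open ContinuousLinearMap InnerProductSpace

variable {E : Type*} [NormedAddCommGroup E] [InnerProductSpace ℂ E]

lemma tmul_smul {F : Type*} [NormedAddCommGroup F] [InnerProductSpace ℂ F]
    (c : ℂ) (a : E) (b : F) : tmul a (c • b) = c • tmul a b :=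
  map_smul (tmulLeft a) c b

lemma adjoint_insertSecond_tmul [CompleteSpace E] (e a b c : E) :
    adjoint (insertSecond (E := E) (G := E) e) (tmul a (tmul b c)) = ⟪e, b⟫_ℂ • tmul a c := by
  rw [insertSecond, adjoint_opTensor, opTensor_tmul, adjoint_tmulLeft_tmul, tmul_smul, adjoint_id,
    id_apply]

lemma adjoint_insertThird_tmul [CompleteSpace E] (e a b c : E) :
    adjoint (insertThird (E := E) (F := E) e) (tmul a (tmul b c)) = ⟪e, c⟫_ℂ • tmul a b := by
  rw [insertThird, adjoint_opTensor, opTensor_tmul, adjoint_tmulRight_tmul, tmul_smul, adjoint_id,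
    id_apply]

/-- The value `±1` of a classical bit. -/
def bitSign (x : Bool) : ℝ := if x then 1 else -1

/-- A symmetric distribution on pairs of bits with correlation `1 / 3`. -/
def pairWeight (x : Bool × Bool) : ℝ := (1 + bitSign x.1 * bitSign x.2 / 3) / 4

/-- A distribution on triples of bits whose pairs `(1, 2)` and `(1, 3)` have correlation `1 / 3`,
and whose pair `(2, 3)` has correlation `s / 3`. -/
def tripleWeight (s : ℝ) (x : Bool × Bool × Bool) : ℝ :=
  (1 + (bitSign x.1 * bitSign x.2.1 + bitSign x.1 * bitSign x.2.2 +
    s * (bitSign x.2.1 * bitSign x.2.2)) / 3) / 8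

/-- The classically correlated state with weights `pairWeight`. -/
def pairState (u : Bool → E) : HTensor E E →L[ℂ] HTensor E E :=
  mixture pairWeight fun x => tmul (u x.1) (u x.2)

/-- The classically correlated operator with weights `tripleWeight s`. -/
def tripleState (s : ℝ) (u : Bool → E) : HTensor E (HTensor E E) →L[ℂ] HTensor E (HTensor E E) :=
  mixture (tripleWeight s) fun x => tmul (u x.1) (tmul (u x.2.1) (u x.2.2))

lemma pairWeight_nonneg (x : Bool × Bool) : 0 ≤ pairWeight x := by
  obtain ⟨_ | _, _ | _⟩ := x <;> norm_num [pairWeight, bitSign]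

/-- The sign `s = -1` forces the constant: the bracket then reaches `-3`, when the first bit differs
from the other two, so `1 / 3` is the largest admissible correlation. -/
lemma tripleWeight_nonneg {s : ℝ} (hs : s = 1 ∨ s = -1) (x : Bool × Bool × Bool) :
    0 ≤ tripleWeight s x := by
  obtain ⟨_ | _, _ | _, _ | _⟩ := x <;> rcases hs with rfl | rfl <;>
    norm_num [tripleWeight, bitSign]

lemma prodAverage_pairState (u : Bool → E) (A B : E →L[ℂ] E) :
    prodAverage (pairState u) A B =
      ∑ x, (pairWeight x : ℂ) * (⟪u x.1, A (u x.1)⟫_ℂ * ⟪u x.2, B (u x.2)⟫_ℂ) := by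
  simp only [prodAverage, pairState, trace_mixture_comp _ pairWeight_nonneg, opTensor_tmul,
    inner_tmul]

lemma exists_orthonormal_bool (h : 2 ≤ Module.rank ℂ E) : ∃ u : Bool → E, Orthonormal ℂ u := by
  have hne : ∃ x : E, x ≠ 0 := by
    by_contra! h0
    have : Subsingleton E := ⟨fun a b => by rw [h0 a, h0 b]⟩
    simp at h
  obtain ⟨x, hx⟩ := hne
  have hK : (ℂ ∙ x)ᗮ ≠ ⊥ := fun h0 => by
    rw [Submodule.orthogonal_eq_bot_iff] at h0
    -- A trivial complement would make the line `ℂ ∙ x` the whole space, of rank at most one.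
    have h1 := h.trans ((rank_top ℂ E).symm.le.trans (h0 ▸ rank_span_le _))
    rw [Cardinal.mk_singleton] at h1
    norm_num at h1
  obtain ⟨y, hy, hy0⟩ := Submodule.exists_mem_ne_zero_of_ne_bot hK
  have hxy : ⟪x, y⟫_ℂ = 0 := Submodule.mem_orthogonal_singleton_iff_inner_right.1 hy
  have hyx : ⟪y, x⟫_ℂ = 0 := inner_eq_zero_symm.1 hxy
  refine ⟨fun i => if i then (‖x‖⁻¹ : ℂ) • x else (‖y‖⁻¹ : ℂ) • y, ?_, ?_⟩
  · rintro (_ | _) <;> simp [norm_smul, hx, hy0]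
  · rintro (_ | _) (_ | _) hij <;> simp_all [inner_smul_left, inner_smul_right]

lemma isSymmetricState_pairState [CompleteSpace E] (u : Bool → E) : IsSymmetricState (pairState u) := by
  rw [IsSymmetricState, pairState, mixture, finsetSum_comp, comp_finsetSum]
  simp only [smul_comp, comp_smul, rankOne_comp, comp_rankOne, adjoint_swap, swap_tmul,
    Fintype.sum_prod_type, Fintype.sum_bool, pairWeight, bitSign]
  module

variable [CompleteSpace E] {u : Bool → E} (hu : Orthonormal ℂ u)
include hu

lemma hasSum_norm_inner_stdBasis_sq (x : Bool) :
    HasSum (fun i => ‖⟪stdBasis E i, u x⟫_ℂ‖ ^ 2) 1 := by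
  simpa [hu.1 x] using hilbertBasis_hasSum_norm_sq (stdBasis E) (u x)

lemma ptraceFirst_tripleState (s : ℝ) :
    ptraceFirst (tripleState s u) = mixture (tripleWeight s) fun x => tmul (u x.2.1) (u x.2.2) :=
  slicedTrace_mixture (fun _ _ => adjoint_tmulLeft_tmul _ _ _)
    fun x => hasSum_norm_inner_stdBasis_sq hu x.1

/-- Summing over the second bit cancels both correlation terms containing it and leaves
`pairWeight`. -/
lemma ptraceSecond_tripleState (s : ℝ) : ptraceSecond (tripleState s u) = pairState u := by
  have h : ∀ (x : Bool × Bool × Bool) (i : basisIndex E),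
      adjoint (insertSecond (stdBasis E i)) (tmul (u x.1) (tmul (u x.2.1) (u x.2.2))) =
        ⟪stdBasis E i, u x.2.1⟫_ℂ • tmul (u x.1) (u x.2.2) :=
    fun x i => adjoint_insertSecond_tmul (stdBasis E i) (u x.1) (u x.2.1) (u x.2.2)
  rw [ptraceSecond_eq_slicedTrace, tripleState,
    slicedTrace_mixture h fun x => hasSum_norm_inner_stdBasis_sq hu x.2.1]
  simp only [mixture, pairState, Fintype.sum_prod_type, Fintype.sum_bool, tripleWeight,
    pairWeight, bitSign]
  push_cast
  module

lemma ptraceThird_tripleState (s : ℝ) : ptraceThird (tripleState s u) = pairState u := by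
  have h : ∀ (x : Bool × Bool × Bool) (i : basisIndex E),
      adjoint (insertThird (stdBasis E i)) (tmul (u x.1) (tmul (u x.2.1) (u x.2.2))) =
        ⟪stdBasis E i, u x.2.2⟫_ℂ • tmul (u x.1) (u x.2.1) :=
    fun x i => adjoint_insertThird_tmul (stdBasis E i) (u x.1) (u x.2.1) (u x.2.2)
  rw [ptraceThird_eq_slicedTrace, tripleState,
    slicedTrace_mixture h fun x => hasSum_norm_inner_stdBasis_sq hu x.2.2]
  simp only [mixture, pairState, Fintype.sum_prod_type, Fintype.sum_bool, tripleWeight,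
    pairWeight, bitSign]
  push_cast
  module

lemma isDSO122_tripleState {s : ℝ} (hs : s = 1 ∨ s = -1) :
    IsDSO122 (pairState u) (tripleState s u) :=
  have hpos := mixture_isPositive _ (tripleWeight_nonneg hs)
  ⟨⟨hpos.isSelfAdjoint, mixture_isTraceClass _ (tripleWeight_nonneg hs),
    ptraceSecond_tripleState hu s, ptraceThird_tripleState hu s⟩, hpos⟩

omit [CompleteSpace E] in
lemma isDensityOperator_pairState : IsDensityOperator (pairState u) where
  isPositive := mixture_isPositive _ pairWeight_nonneg
  isTraceClass := mixture_isTraceClass _ pairWeight_nonneg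
  trace_eq_one := by
    have h := prodAverage_pairState u (.id ℂ E) (.id ℂ E)
    rw [prodAverage, opTensor_id, comp_id] at h
    rw [h]
    simp [Fintype.sum_prod_type, hu.1, pairWeight, bitSign]
    norm_num

lemma isDSOState_pairState : IsDSOState (pairState u) :=
  ⟨isDensityOperator_pairState hu, .inr ⟨_, isDSO122_tripleState hu (.inl rfl)⟩⟩

/-- `W'` enters only through `f x = ⟪u x, W' (u x)⟫`, and both sides equal `s (f true - f false) /
6`. -/
lemma sufficientCondition_tripleState {s : ℝ} (hs : s = 1 ∨ s = -1) {W : E →L[ℂ] E}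
    (hW : ∀ x, W (u x) = (bitSign x : ℂ) • u x) (W' : E →L[ℂ] E) :
    SufficientCondition s (pairState u) (tripleState s u) W W' := by
  rw [SufficientCondition, prodAverage_pairState, prodAverage, ptraceFirst_tripleState hu,
    trace_mixture_comp _ (tripleWeight_nonneg hs)]
  simp [opTensor_tmul, inner_tmul, hW, hu.1, Fintype.sum_prod_type, tripleWeight,
    pairWeight, bitSign]
  ring

omit [CompleteSpace E] in
lemma prodAverage_pairState_self {W : E →L[ℂ] E}
    (hW : ∀ x, W (u x) = (bitSign x : ℂ) • u x) : prodAverage (pairState u) W W = 1 / 3 := by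
  rw [prodAverage_pairState]
  simp [hW, hu.1, Fintype.sum_prod_type, pairWeight, bitSign]
  norm_num

/-- The reflection which fixes `u true` and maps `u false` to its negative. -/
lemma exists_reflection : ∃ W : E →L[ℂ] E, IsUnitObservable W ∧
    W ∘L W = ContinuousLinearMap.id ℂ E ∧ ∀ x, W (u x) = (bitSign x : ℂ) • u x := by
  let S := (ℂ ∙ u false)ᗮ
  refine ⟨S.reflection.toContinuousLinearEquiv, ⟨?_, ?_⟩, ?_, ?_⟩
  -- An isometric involution is symmetric: replace `y` by its reflection in the isometry identity.
  · rw [isSelfAdjoint_iff_isSymmetric]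
    intro x y
    have := S.reflection.inner_map_map x (S.reflection y)
    rw [Submodule.reflection_reflection] at this
    exact this
  · exact S.reflection.toLinearIsometry.norm_toContinuousLinearMap_le
  · ext x
    exact Submodule.reflection_reflection S x
  · rintro (_ | _)
    · simpa [bitSign] using
        Submodule.reflection_orthogonalComplement_singleton_eq_neg (𝕜 := ℂ) (u false)
    · have : u true ∈ S := Submodule.mem_orthogonal_singleton_iff_inner_right.2
        (hu.2 Bool.false_ne_true)
      simpa [bitSign] using Submodule.reflection_mem_subspace_eq_self this

end Counterexample

end BellDSO

end

theorem proposition5 {H : Type*} [NormedAddCommGroup H] [InnerProductSpace ℂ H] [CompleteSpace H]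
    [TopologicalSpace.SeparableSpace H] (s : ℝ) (hs : s = 1 ∨ s = -1) :
    (∀ (ρ : BellDSO.HTensor H H →L[ℂ] BellDSO.HTensor H H) (W : H →L[ℂ] H),
        BellDSO.IsDSOState ρ → BellDSO.IsSymmetricState ρ → BellDSO.IsUnitObservable W →
        BellDSO.prodAverage ρ W W = s →
        ∃ R, BellDSO.IsDSO122 ρ R ∧
          ∀ W' : H →L[ℂ] H, BellDSO.IsUnitObservable W' →
            BellDSO.SufficientCondition s ρ R W W') ∧
    (2 ≤ Module.rank ℂ H →
      ∃ (ρ : BellDSO.HTensor H H →L[ℂ] BellDSO.HTensor H H) (W : H →L[ℂ] H),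
        BellDSO.IsDSOState ρ ∧ BellDSO.IsSymmetricState ρ ∧ BellDSO.IsUnitObservable W ∧
        W ∘L W = ContinuousLinearMap.id ℂ H ∧
        (∃ R, BellDSO.IsDSO122 ρ R ∧
          ∀ W' : H →L[ℂ] H, BellDSO.IsUnitObservable W' →
            BellDSO.SufficientCondition s ρ R W W') ∧
        BellDSO.prodAverage ρ W W ≠ 1 ∧ BellDSO.prodAverage ρ W W ≠ -1) := by
  refine ⟨fun ρ W hρ hsymm hW h => ?_, fun hrank => ?_⟩
  · obtain ⟨R, hR⟩ := hsymm.exists_isDSO122 hρ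
    have hss : s * s = 1 := by rcases hs with rfl | rfl <;> norm_num
    exact ⟨R, hR, fun W' _ => hR.sufficientCondition hρ.1.trace_eq_one hW hss h W'⟩
  · obtain ⟨u, hu⟩ := BellDSO.exists_orthonormal_bool hrank
    obtain ⟨W, hW, hW2, hWu⟩ := BellDSO.exists_reflection hu
    -- The state and `W` serve both signs; only the source-operator depends on `s`.
    refine ⟨BellDSO.pairState u, W, BellDSO.isDSOState_pairState hu,
      BellDSO.isSymmetricState_pairState u, hW, hW2, ⟨_, BellDSO.isDSO122_tripleState hu hs,
        fun W' _ => BellDSO.sufficientCondition_tripleState hu hs hWu W'⟩, ?_⟩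
    rw [BellDSO.prodAverage_pairState_self hu hWu]
    norm_num
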